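/- Let $(\Omega,\mathcal F,(\mathcal F_t)_{0\le t\le T},\mathbb P)$ be a filtered probability space and let the price $S=(S_t)_{0\le t\le T}$ of a risky asset be a locally bounded real semimartingale that admits an equivalent local martingale measure; the interest rate is zero. For $x\in\mathbb R$ let $\mathcal X(x)$ be the set of wealth processes $X_t=x+\int_0^t\xi_s\,dS_s$, with $\xi$ predictable and $S$-integrable, for which there is a constant $c$ with $X_t\ge c$ for all $t\in[0,T]$ almost surely. Let the payoff of a European option be $F(S_T,Y_T)$, with $Y$ an adapted $\mathbb R^d$-valued process and $F$ measurable. A risk measure $\rho$ assigns a value in $[-\infty,\infty]$ to $\mathcal F_T$-measurable random liabilities; it is defined at least on $\mathcal L_p(\Omega,\mathcal F_T,\mathbb P)$ for some $p\in[1,\infty]$, and depends only on almost sure equivalence classes. It is a convex risk measure if it is monotone ($X\le Z$ a.s. implies $\rho(X)\le\rho(Z)$), convex ($\rho(\lambda X+(1-\lambda)Z)\le\lambda\rho(X)+(1-\lambda)\rho(Z)$ for $0\le\lambda\le1$, whenever the right-hand side does not involve $\infty-\infty$), translation invariant ($\rho(X+m)=\rho(X)+m$ for $m\in\mathbb R$)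 and normalized ($\rho(0)=0$). Given the risk measures $\rho^w$ of the writer and $\rho^b$ of the buyer, set for $p_0\in\mathbb R$ $$\varrho^w(p_0)=\inf_{X\in\mathcal X(p_0)}\rho^w\big(F(S_T,Y_T)-X_T\big),\qquad \varrho^b(p_0)=\inf_{X\in\mathcal X(-p_0)}\rho^b\big(-F(S_T,Y_T)-X_T\big),$$ where the infima (in $[-\infty,\infty]$) run over those $X$ for which the risk is defined. An equal risk price is a real number $p_0^*$ that is the unique solution of $\varrho^w(p_0^*)=\varrho^b(p_0^*)\in\mathbb R$. The fair price interval is $[p_0^b,p_0^w]$, where $p_0^b=\sup\{p_0\in\mathbb R:\varrho^b(p_0)\le0\}$ and $p_0^w=\inf\{p_0\in\mathbb R:\varrho^w(p_0)\le0\}$ in $[-\infty,\infty]$; it is called bounded if $p_0^b$ and $p_0^w$ are both real numbers (it may be empty, namely if $p_0^w<p_0^b$). Suppose that $\rho^w$ and $\rho^b$ are convex risk measures. Then an equal risk price exists if and only if the fair price interval is bounded. Moreover, when it exists, $\varrho^w(0)$ and $\varrho^b(0)$ are real and the equal risk price equals $$p_0^*=\frac{\varrho^w(0)-\varrho^b(0)}2=\frac{p_0^b+p_0^w}2,$$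 which is the center of the fair price interval if the latter is non-empty. -/

import Mathlib

open MeasureTheory ProbabilityTheory Filter Topology
open scoped NNReal ENNReal

/-! ### The market: semimartingales and stochastic integrals -/

section Market

variable {Ω : Type*} {mΩ : MeasurableSpace Ω} {ι : Type*} [LinearOrder ι] [TopologicalSpace ι]

/-- A path is càdlàg: right-continuous with left limits. -/
def IsCadlagPath (f : ι → ℝ) : Prop :=
  ∀ t, ContinuousWithinAt f (Set.Ici t) t ∧ ∃ l, Tendsto f (𝓝[<] t) (𝓝 l)

variable [OrderTopology ι] [OrderBot ι]

/-- Local martingales with almost surely càdlàg paths. -/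
def IsLocalMartingale (𝓕 : Filtration ι mΩ) (P : Measure Ω) (M : ι → Ω → ℝ) : Prop :=
  StronglyAdapted 𝓕 M ∧ (∀ᵐ ω ∂P, IsCadlagPath (fun t => M t ω)) ∧
    Locally (fun X => Martingale X 𝓕 P) 𝓕 M P

/-- Semimartingales: adapted processes with càdlàg paths that are the sum of a local martingale
and an adapted càdlàg process with paths of finite variation. -/
def IsSemimartingale (𝓕 : Filtration ι mΩ) (P : Measure Ω) (S : ι → Ω → ℝ) : Prop :=
  StronglyAdapted 𝓕 S ∧ (∀ᵐ ω ∂P, IsCadlagPath (fun t => S t ω)) ∧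
    ∃ M A : ι → Ω → ℝ, IsLocalMartingale 𝓕 P M ∧ StronglyAdapted 𝓕 A ∧
      (∀ᵐ ω ∂P, IsCadlagPath (fun t => A t ω)) ∧
      (∀ᵐ ω ∂P, LocallyBoundedVariationOn (fun t => A t ω) Set.univ) ∧
      ∀ᵐ ω ∂P, ∀ t, S t ω = M t ω + A t ω

/-- Locally bounded processes: the processes stopped along some localizing sequence are bounded. -/
def IsLocallyBounded (𝓕 : Filtration ι mΩ) (P : Measure Ω) (S : ι → Ω → ℝ) : Prop :=
  Locally (fun X => ∃ C : ℝ, ∀ᵐ ω ∂P, ∀ t, |X t ω| ≤ C) 𝓕 S P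

/-- `Q` is an equivalent local martingale measure for `S`. -/
def IsEquivLocalMartingaleMeasure (𝓕 : Filtration ι mΩ) (P : Measure Ω) (S : ι → Ω → ℝ)
    (Q : Measure Ω) : Prop :=
  IsProbabilityMeasure Q ∧ Q ≪ P ∧ P ≪ Q ∧ IsLocalMartingale 𝓕 Q S

/-- The data of an elementary predictable integrand
`h₀ 1_{0} + ∑ i, h i 1_{(s i, t i]}` with `h i` bounded and `𝓕 (s i)`-measurable. -/
structure ElementaryIntegrand (𝓕 : Filtration ι mΩ) where
  h₀ : Ω → ℝ
  n : ℕ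
  s : Fin n → ι
  t : Fin n → ι
  h : Fin n → Ω → ℝ
  s_le_t : ∀ i, s i ≤ t i
  measurable_h₀ : StronglyMeasurable[𝓕 ⊥] h₀
  measurable_h : ∀ i, StronglyMeasurable[𝓕 (s i)] (h i)
  bounded_h₀ : ∃ C : ℝ, ∀ ω, |h₀ ω| ≤ C
  bounded_h : ∃ C : ℝ, ∀ i ω, |h i ω| ≤ C

/-- The process defined by an elementary integrand. -/
noncomputable def ElementaryIntegrand.process {𝓕 : Filtration ι mΩ} (K : ElementaryIntegrand 𝓕) :
    ι → Ω → ℝ := fun u ω =>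
  ({⊥} : Set ι).indicator (fun _ => K.h₀ ω) u +
    ∑ i, (Set.Ioc (K.s i) (K.t i)).indicator (fun _ => K.h i ω) u

/-- The integral of an elementary integrand:
`(K • S)_u = ∑ i, h i (S_{t i ∧ u} - S_{s i ∧ u})`. -/
def ElementaryIntegrand.integral {𝓕 : Filtration ι mΩ} (K : ElementaryIntegrand 𝓕)
    (S : ι → Ω → ℝ) : ι → Ω → ℝ := fun u ω =>
  ∑ i, K.h i ω * (S (min (K.t i) u) ω - S (min (K.s i) u) ω)

/-- Uniform convergence in probability of processes (over the whole time set). -/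
def TendstoUCP (P : Measure Ω) (X : ℕ → ι → Ω → ℝ) (Y : ι → Ω → ℝ) : Prop :=
  ∀ ε : ℝ, 0 < ε → Tendsto (fun n => P {ω | ∃ t, ε ≤ |X n t ω - Y t ω|}) atTop (𝓝 0)

/-- `IsBoundedStochIntegral 𝓕 P S H X`: the process `X` is (a version of) the stochastic integral
`∫ H dS` of the bounded predictable integrand `H`. This is the extension of the elementary integral
along uniformly bounded pointwise limits of integrands, the integrals converging uniformly in
probability. For a semimartingale `S` every bounded predictable `H` is reached (monotone class
theorem and dominated convergence), and `X` is unique up to indistinguishability. -/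
inductive IsBoundedStochIntegral (𝓕 : Filtration ι mΩ) (P : Measure Ω) (S : ι → Ω → ℝ) :
    (ι → Ω → ℝ) → (ι → Ω → ℝ) → Prop
  | elementary (K : ElementaryIntegrand 𝓕) :
      IsBoundedStochIntegral 𝓕 P S K.process (K.integral S)
  | limit (H X : ℕ → ι → Ω → ℝ) (H' X' : ι → Ω → ℝ) (C : ℝ)
      (hHX : ∀ n, IsBoundedStochIntegral 𝓕 P S (H n) (X n))
      (hC : ∀ n t ω, |H n t ω| ≤ C)
      (hH : ∀ t ω, Tendsto (fun n => H n t ω) atTop (𝓝 (H' t ω)))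
      (hX : TendstoUCP P X X') :
      IsBoundedStochIntegral 𝓕 P S H' X'

/-- Convergence of integral processes (null at time `0`) in the semimartingale (Émery) topology:
`K • (X n - Y) → 0` uniformly in probability, uniformly over the elementary predictable `K`
with `|K| ≤ 1`. -/
def TendstoEmery (𝓕 : Filtration ι mΩ) (P : Measure Ω) (X : ℕ → ι → Ω → ℝ)
    (Y : ι → Ω → ℝ) : Prop :=
  ∀ ε : ℝ, 0 < ε → ∀ᶠ n in atTop, ∀ K : ElementaryIntegrand 𝓕,
    (∀ t ω, |K.process t ω| ≤ 1) →
      P {ω | ∃ t, ε ≤ |K.integral (fun u ω => X n u ω - Y u ω) t ω|} ≤ ENNReal.ofReal ε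

/-- `IsStochIntegral 𝓕 P S ξ X`: the predictable process `ξ` is `S`-integrable and
`X_t = ∫_0^t ξ_s dS_s`, i.e. the integrals of the truncations `ξ 1_{|ξ| ≤ n}` converge to `X` in
the semimartingale topology. -/
def IsStochIntegral (𝓕 : Filtration ι mΩ) (P : Measure Ω) (S ξ X : ι → Ω → ℝ) : Prop :=
  IsStronglyPredictable 𝓕 ξ ∧ (∀ᵐ ω ∂P, X ⊥ ω = 0) ∧
    ∃ Xn : ℕ → ι → Ω → ℝ,
      (∀ n : ℕ, IsBoundedStochIntegral 𝓕 P S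
        (fun t ω => {x : ℝ | |x| ≤ n}.indicator id (ξ t ω)) (Xn n)) ∧
      TendstoEmery 𝓕 P Xn X

/-- The wealth processes of admissible self-financing strategies with initial capital `x₀`:
`X_t = x₀ + ∫_0^t ξ_s dS_s ≥ c` for all `t`, for some constant `c`. -/
def admissibleWealth (𝓕 : Filtration ι mΩ) (P : Measure Ω) (S : ι → Ω → ℝ) (x₀ : ℝ) :
    Set (ι → Ω → ℝ) :=
  {X | ∃ ξ G : ι → Ω → ℝ, ∃ c : ℝ, IsStochIntegral 𝓕 P S ξ G ∧
    (X = fun t ω => x₀ + G t ω) ∧ ∀ᵐ ω ∂P, ∀ t, c ≤ X t ω}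

end Market

/-! ### Risk measures -/

section Risk

variable {Ω : Type*} {mΩ : MeasurableSpace Ω}

/-- A risk measure on random liabilities known at the terminal information `𝓖`. It is defined on
all of `L_p(Ω, 𝓖, P)`, possibly also on further liabilities (`dom` is the set of liabilities whose
risk is defined), and has extended real values. -/
structure RiskMeasure (P : Measure Ω) (𝓖 : MeasurableSpace Ω) (p : ℝ≥0∞) where
  dom : Set (Ω → ℝ)
  val : (Ω → ℝ) → EReal
  aestronglyMeasurable_of_mem : ∀ Z ∈ dom, AEStronglyMeasurable[𝓖] Z P
  mem_of_memLp : ∀ Z : Ω → ℝ, AEStronglyMeasurable[𝓖] Z P → MemLp Z p P → Z ∈ dom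
  mem_congr : ∀ Z Z' : Ω → ℝ, Z =ᵐ[P] Z' → Z ∈ dom → Z' ∈ dom
  val_congr : ∀ Z Z' : Ω → ℝ, Z =ᵐ[P] Z' → Z ∈ dom → val Z = val Z'

variable {P : Measure Ω} {𝓖 : MeasurableSpace Ω} {p : ℝ≥0∞}

/-- Convex risk measures: monotone, convex, translation invariant and normalized. Convexity is
stated on the epigraph, so that no form `∞ - ∞` occurs. -/
structure RiskMeasure.IsConvex (ρ : RiskMeasure P 𝓖 p) : Prop where
  monotone : ∀ X ∈ ρ.dom, ∀ Z ∈ ρ.dom, X ≤ᵐ[P] Z → ρ.val X ≤ ρ.val Z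
  convex : ∀ X ∈ ρ.dom, ∀ Z ∈ ρ.dom, ∀ l : ℝ, 0 ≤ l → l ≤ 1 →
    (fun ω => l * X ω + (1 - l) * Z ω) ∈ ρ.dom →
    ∀ a b : ℝ, ρ.val X ≤ a → ρ.val Z ≤ b →
      ρ.val (fun ω => l * X ω + (1 - l) * Z ω) ≤ ((l * a + (1 - l) * b : ℝ) : EReal)
  translation : ∀ X ∈ ρ.dom, ∀ m : ℝ,
    (fun ω => X ω + m) ∈ ρ.dom ∧ ρ.val (fun ω => X ω + m) = ρ.val X + (m : EReal)
  normalized : ρ.val (fun _ => 0) = 0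

/-- The minimal risk of the terminal position `L - X_T`, over the admissible wealth processes `X`
with initial capital `x₀` (for which this risk is defined). -/
noncomputable def minimalRisk {T : ℝ≥0} (𝓕 : Filtration (Set.Iic T) mΩ)
    (S : Set.Iic T → Ω → ℝ) (ρ : RiskMeasure P (𝓕 ⊤) p) (L : Ω → ℝ) (x₀ : ℝ) : EReal :=
  ⨅ X ∈ {X ∈ admissibleWealth 𝓕 P S x₀ | (fun ω => L ω - X ⊤ ω) ∈ ρ.dom},
    ρ.val (fun ω => L ω - X ⊤ ω)

/-- The writer's minimal risk when the contract with payoff `F` is sold at price `p₀`. -/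
noncomputable def writerRisk {T : ℝ≥0} (𝓕 : Filtration (Set.Iic T) mΩ)
    (S : Set.Iic T → Ω → ℝ) (ρ : RiskMeasure P (𝓕 ⊤) p) (F : Ω → ℝ) (p₀ : ℝ) : EReal :=
  minimalRisk 𝓕 S ρ F p₀

/-- The buyer's minimal risk when the contract with payoff `F` is bought at price `p₀`. -/
noncomputable def buyerRisk {T : ℝ≥0} (𝓕 : Filtration (Set.Iic T) mΩ)
    (S : Set.Iic T → Ω → ℝ) (ρ : RiskMeasure P (𝓕 ⊤) p) (F : Ω → ℝ) (p₀ : ℝ) : EReal :=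
  minimalRisk 𝓕 S ρ (fun ω => -F ω) (-p₀)

end Risk

/-! ### Prices, in terms of the minimal risks `rw` of the writer and `rb` of the buyer -/

/-- `p₀` equalizes the two minimal risks, at a real value. -/
def EqualizesRisk (rw rb : ℝ → EReal) (p₀ : ℝ) : Prop :=
  rw p₀ = rb p₀ ∧ ∃ r : ℝ, rw p₀ = (r : EReal)

/-- The equal risk price is the unique price that equalizes the risks, when it exists. -/
def IsEqualRiskPrice (rw rb : ℝ → EReal) (p₀ : ℝ) : Prop :=
  EqualizesRisk rw rb p₀ ∧ ∀ q, EqualizesRisk rw rb q → q = p₀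

/-- Lower end of the fair price interval, `sup {p₀ | rb p₀ ≤ 0}`, in the extended reals. -/
noncomputable def fairPriceLower (rb : ℝ → EReal) : EReal :=
  sSup ((fun x : ℝ => (x : EReal)) '' {p₀ | rb p₀ ≤ 0})

/-- Upper end of the fair price interval, `inf {p₀ | rw p₀ ≤ 0}`, in the extended reals. -/
noncomputable def fairPriceUpper (rw : ℝ → EReal) : EReal :=
  sInf ((fun x : ℝ => (x : EReal)) '' {p₀ | rw p₀ ≤ 0})

/-- The fair price interval, as a (possibly empty) set of real prices. -/
def fairPriceInterval (rw rb : ℝ → EReal) : Set ℝ :=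
  {x | fairPriceLower rb ≤ (x : EReal) ∧ (x : EReal) ≤ fairPriceUpper rw}

/-- The fair price interval is bounded: both of its ends are real numbers. -/
def FairPriceIntervalBounded (rw rb : ℝ → EReal) : Prop :=
  (∃ l : ℝ, fairPriceLower rb = (l : EReal)) ∧ ∃ u : ℝ, fairPriceUpper rw = (u : EReal)

/-!
Adding the constant `m` to a wealth process turns strategies with initial capital `x₀` into
strategies with initial capital `x₀ + m`, so translation invariance of the risk measure makes the
minimal risk cash invariant: `minimalRisk_add`. Hence the writer's risk is `p ↦ rw 0 - p` and the
buyer's risk is `p ↦ rb 0 + p`, with `rw 0` and `rb 0` in the extended reals.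

For such functions the ends of the fair price interval are `rw 0` (`fairPriceUpper_eq`) and `-rb 0`
(`fairPriceLower_eq`), infinite values included, and a price equalizes the risks at a real value
exactly if `rw 0`, `rb 0` are real numbers `a`, `b` and `a - p = b + p`
(`equalizesRisk_iff`). So an equal risk price exists iff `rw 0` and `rb 0` are real, that is, iff
the fair price interval is bounded, and then it equals `(a - b) / 2`.
-/

theorem EReal.add_coe_le_iff {a b : EReal} {m : ℝ} :
    a + (m : EReal) ≤ b ↔ a ≤ b + ((-m : ℝ) : EReal) := by
  induction a <;> induction b <;> simp [← EReal.coe_add, -EReal.coe_neg]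

theorem admissibleWealth_add_const {Ω : Type*} {mΩ : MeasurableSpace Ω} {ι : Type*} [LinearOrder ι]
    [TopologicalSpace ι] [OrderTopology ι] [OrderBot ι] {𝓕 : Filtration ι mΩ} {P : Measure Ω}
    {S X : ι → Ω → ℝ} {x₀ : ℝ} (hX : X ∈ admissibleWealth 𝓕 P S x₀) (m : ℝ) :
    (fun t ω => X t ω + m) ∈ admissibleWealth 𝓕 P S (x₀ + m) := by
  obtain ⟨ξ, G, c, hG, rfl, hc⟩ := hX
  refine ⟨ξ, G, c + m, hG, by funext t ω; ring, ?_⟩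
  filter_upwards [hc] with ω hω t
  exact add_le_add_left (hω t) m

section Risk

variable {Ω : Type*} {mΩ : MeasurableSpace Ω} {P : Measure Ω} {p : ℝ≥0∞} {T : ℝ≥0}
  {𝓕 : Filtration (Set.Iic T) mΩ}

theorem minimalRisk_add_le (S : Set.Iic T → Ω → ℝ) {ρ : RiskMeasure P (𝓕 ⊤) p}
    (hρ : ρ.IsConvex) (L : Ω → ℝ) (x₀ m : ℝ) :
    minimalRisk 𝓕 S ρ L (x₀ + m) ≤ minimalRisk 𝓕 S ρ L x₀ + ((-m : ℝ) : EReal) := by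
  rw [← EReal.add_coe_le_iff]
  refine le_iInf₂ fun X hX => ?_
  obtain ⟨hdom, hval⟩ := hρ.translation _ hX.2 (-m)
  have key : (fun ω => L ω - X ⊤ ω + -m) = fun ω => L ω - (X ⊤ ω + m) := by
    funext ω; ring
  rw [EReal.add_coe_le_iff, ← hval, key]
  rw [key] at hdom
  have hmem : (fun t ω => X t ω + m) ∈ {X ∈ admissibleWealth 𝓕 P S (x₀ + m) |
      (fun ω => L ω - X ⊤ ω) ∈ ρ.dom} := ⟨admissibleWealth_add_const hX.1 m, hdom⟩
  exact iInf₂_le (f := fun (X : Set.Iic T → Ω → ℝ) _ => ρ.val fun ω => L ω - X ⊤ ω) _ hmem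

/-- Cash invariance of the minimal risk. -/
theorem minimalRisk_add (S : Set.Iic T → Ω → ℝ) {ρ : RiskMeasure P (𝓕 ⊤) p}
    (hρ : ρ.IsConvex) (L : Ω → ℝ) (x₀ m : ℝ) :
    minimalRisk 𝓕 S ρ L (x₀ + m) = minimalRisk 𝓕 S ρ L x₀ + ((-m : ℝ) : EReal) := by
  refine le_antisymm (minimalRisk_add_le S hρ L x₀ m) ?_
  -- The reverse inequality is the same one, for the capital `x₀ + m` changed by `-m`.
  rw [EReal.add_coe_le_iff]
  simpa using minimalRisk_add_le S hρ L (x₀ + m) (-m)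

end Risk

section Prices

variable {rw rb : ℝ → EReal}

theorem fairPriceUpper_eq (hw : ∀ p : ℝ, rw p = rw 0 + ((-p : ℝ) : EReal)) :
    fairPriceUpper rw = rw 0 := by
  have mem_iff (p : ℝ) : rw p ≤ 0 ↔ rw 0 ≤ p := by
    rw [hw, EReal.add_coe_le_iff]; simp
  refine le_antisymm (EReal.le_of_forall_lt_iff_le.1 fun z hz => ?_) ?_
  · exact sInf_le ⟨z, (mem_iff z).2 hz.le, rfl⟩
  · refine le_sInf ?_
    rintro _ ⟨p, hp, rfl⟩
    exact (mem_iff p).1 hp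

theorem fairPriceLower_eq (hb : ∀ p : ℝ, rb p = rb 0 + (p : EReal)) :
    fairPriceLower rb = -rb 0 := by
  have mem_iff (p : ℝ) : rb p ≤ 0 ↔ (p : EReal) ≤ -rb 0 := by
    rw [hb, EReal.add_coe_le_iff, EReal.le_neg]; simp
  refine le_antisymm ?_ (EReal.ge_of_forall_gt_iff_ge.1 fun z hz => ?_)
  · refine sSup_le ?_
    rintro _ ⟨p, hp, rfl⟩
    exact (mem_iff p).1 hp
  · exact le_sSup ⟨z, (mem_iff z).2 hz.le, rfl⟩

theorem equalizesRisk_iff (hw : ∀ p : ℝ, rw p = rw 0 + ((-p : ℝ) : EReal))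
    (hb : ∀ p : ℝ, rb p = rb 0 + (p : EReal)) (p : ℝ) :
    EqualizesRisk rw rb p ↔
      ∃ a b : ℝ, rw 0 = (a : EReal) ∧ rb 0 = (b : EReal) ∧ p = (a - b) / 2 := by
  constructor
  · rintro ⟨h, r, hr⟩
    rw [hr] at h
    rw [hw] at hr
    rw [hb] at h
    generalize rw 0 = x at hr
    generalize rb 0 = y at h
    induction x <;> induction y <;> simp [← EReal.coe_add, -EReal.coe_neg] at hr h ⊢
    linarith
  · rintro ⟨a, b, ha, hb', rfl⟩
    refine ⟨?_, a - (a - b) / 2, ?_⟩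
    · rw [hw, hb, ha, hb', ← EReal.coe_add, ← EReal.coe_add]
      congr 1; ring
    · rw [hw, ha, ← EReal.coe_add, ← sub_eq_add_neg]

theorem isEqualRiskPrice_iff (hw : ∀ p : ℝ, rw p = rw 0 + ((-p : ℝ) : EReal))
    (hb : ∀ p : ℝ, rb p = rb 0 + (p : EReal)) (p : ℝ) :
    IsEqualRiskPrice rw rb p ↔
      ∃ a b : ℝ, rw 0 = (a : EReal) ∧ rb 0 = (b : EReal) ∧ p = (a - b) / 2 := by
  rw [IsEqualRiskPrice, equalizesRisk_iff hw hb, and_iff_left_of_imp]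
  rintro ⟨a, b, ha, hb', rfl⟩ q hq
  obtain ⟨a', b', ha', hb'', rfl⟩ := (equalizesRisk_iff hw hb q).1 hq
  rw [EReal.coe_injective (ha.symm.trans ha'), EReal.coe_injective (hb'.symm.trans hb'')]

end Prices

theorem proposition1 {Ω : Type*} {mΩ : MeasurableSpace Ω} (P : Measure Ω) [IsProbabilityMeasure P]
    (T : ℝ≥0) (𝓕 : Filtration (Set.Iic T) mΩ)
    (S : Set.Iic T → Ω → ℝ)
    (hS : IsSemimartingale 𝓕 P S) (hSb : IsLocallyBounded 𝓕 P S)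
    (hQ : ∃ Q : Measure Ω, IsEquivLocalMartingaleMeasure 𝓕 P S Q)
    (d : ℕ) (Y : Set.Iic T → Ω → (Fin d → ℝ)) (hY : StronglyAdapted 𝓕 Y)
    (F : ℝ → (Fin d → ℝ) → ℝ) (hF : Measurable (Function.uncurry F))
    (p : ℝ≥0∞) (hp : 1 ≤ p)
    (ρw ρb : RiskMeasure P (𝓕 ⊤) p) (hρw : ρw.IsConvex) (hρb : ρb.IsConvex)
    (rw rb : ℝ → EReal)
    (hrw : rw = writerRisk 𝓕 S ρw (fun ω => F (S ⊤ ω) (Y ⊤ ω)))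
    (hrb : rb = buyerRisk 𝓕 S ρb (fun ω => F (S ⊤ ω) (Y ⊤ ω))) :
    ((∃ p₀ : ℝ, IsEqualRiskPrice rw rb p₀) ↔ FairPriceIntervalBounded rw rb) ∧
    ∀ p₀ : ℝ, IsEqualRiskPrice rw rb p₀ →
      (∃ a b : ℝ, rw 0 = (a : EReal) ∧ rb 0 = (b : EReal) ∧ p₀ = (a - b) / 2) ∧
      (∃ l u : ℝ, fairPriceLower rb = (l : EReal) ∧ fairPriceUpper rw = (u : EReal) ∧
        fairPriceInterval rw rb = Set.Icc l u ∧ p₀ = (l + u) / 2) := by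
  have hw (q : ℝ) : rw q = rw 0 + ((-q : ℝ) : EReal) := by
    simpa [hrw, writerRisk] using
      minimalRisk_add S hρw (fun ω => F (S ⊤ ω) (Y ⊤ ω)) 0 q
  have hb (q : ℝ) : rb q = rb 0 + (q : EReal) := by
    simpa [hrb, buyerRisk] using
      minimalRisk_add S hρb (fun ω => -F (S ⊤ ω) (Y ⊤ ω)) 0 (-q)
  have hu := fairPriceUpper_eq hw
  have hl := fairPriceLower_eq hb
  refine ⟨⟨?_, ?_⟩, ?_⟩
  · rintro ⟨p₀, h⟩
    obtain ⟨a, b, ha, hb', -⟩ := (isEqualRiskPrice_iff hw hb p₀).1 h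
    exact ⟨⟨-b, by rw [hl, hb', EReal.coe_neg]⟩, a, by rw [hu, ha]⟩
  · rintro ⟨⟨l, hl'⟩, u, hu'⟩
    refine ⟨(u - -l) / 2, (isEqualRiskPrice_iff hw hb _).2 ⟨u, -l, hu ▸ hu', ?_, rfl⟩⟩
    rw [EReal.coe_neg, ← hl', hl, neg_neg]
  · intro p₀ h
    obtain ⟨a, b, ha, hb', rfl⟩ := (isEqualRiskPrice_iff hw hb p₀).1 h
    have hl' : fairPriceLower rb = ((-b : ℝ) : EReal) := by rw [hl, hb', EReal.coe_neg]
    have hu' : fairPriceUpper rw = (a : EReal) := by rw [hu, ha]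
    refine ⟨⟨a, b, ha, hb', rfl⟩, -b, a, hl', hu', ?_, by ring⟩
    ext x
    simp [fairPriceInterval, hl', hu', -EReal.coe_neg]
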